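/- **Setting.** Let $G=\rtimes_{i=1}^{\ell}F_{n_i}=F_{n_\ell}\rtimes_{\alpha_\ell}(\cdots\rtimes_{\alpha_3}(F_{n_2}\rtimes_{\alpha_2}F_{n_1}))$ be an almost-direct product of free groups: an iterated semidirect product of finitely generated free groups in which, for each $j$, the group $\rtimes_{i=1}^{j-1}F_{n_i}$ acts (on the right, $\alpha_j(g)(f)=g^{-1}fg$) on $F_{n_j}$ by automorphisms that induce the identity on $H_1(F_{n_j};\mathbb Z)$. Let $F_{n_i}$ be freely generated by $x_{i,1},\dots,x_{i,n_i}$ and let $N=\sum_i n_i$. Let $\mathfrak a\colon G\to\mathbb Z^N$ be the homomorphism that sends $x_{i,p}$ to the standard generator $t_{i,p}$, and let $e_{i,p}\in H^1(\mathbb Z^N;\mathbb Z)$ be the dual basis. For $i<j$, $1\le p\le n_i$, $1\le q\le n_j$ put $w_{i,j}^{p,q}=x_{j,q}^{-1}\,\alpha_j(x_{i,p})(x_{j,q})\in F_{n_j}$, so that $x_{j,q}x_{i,p}=x_{i,p}x_{j,q}w_{i,j}^{p,q}$ in $G$. Given expressions $w_{i,j}^{p,q}=\prod_{k=1}^m[u_k,v_k]$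 with $u_k,v_k\in F_{n_j}$ and $[u,v]=uvu^{-1}v^{-1}$, define integers, for $1\le r<s\le n_j$, $$c_{i,j}^{p,q,r,s}=\sum_{k=1}^m\Big(\epsilon\big(\tfrac{\partial u_k}{\partial x_{j,r}}\big)\epsilon\big(\tfrac{\partial v_k}{\partial x_{j,s}}\big)-\epsilon\big(\tfrac{\partial u_k}{\partial x_{j,s}}\big)\epsilon\big(\tfrac{\partial v_k}{\partial x_{j,r}}\big)\Big),$$ where $\partial/\partial x$ are the Fox derivatives and $\epsilon$ is the augmentation. Let $C$ be the integral matrix with rows indexed by $(i,j,p,q)$, $i<j$, and columns indexed by $(j',r,s)$, $r<s$, whose entry is $c_{i,j}^{p,q,r,s}$ if $j'=j$ and $0$ otherwise, let $A=(\,I\mid C\,)$, and for an integral matrix $K$ of the same size as $C$ let $B_K=\binom{K}{I}$. For $1\le j\le\ell$, $1\le p<q\le n_j$ put $$\eta_j^{p,q}=e_{j,p}e_{j,q}+\sum_{i=1}^{j-1}\sum_{r=1}^{n_i}\sum_{s=1}^{n_j}\kappa_{i,j}^{p,q,r,s}\,e_{i,r}e_{j,s}\in H^2(\mathbb Z^N;\mathbb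 Z),$$ where $\kappa_{i,j}^{p,q,r,s}$ is the entry of $K$ in row $(i,j,r,s)$ and column $(j,p,q)$. **Statement.** The map $\mathfrak a$ is the abelianization of $G$ (it is surjective with kernel $[G,G]$), and each $w_{i,j}^{p,q}$ is a product of commutators of elements of $F_{n_j}$. For every choice of such expressions there is exactly one integral matrix $K$ with $AB_K=0$, namely $K=-C$ (so $\kappa_{i,j}^{p,q,r,s}=-c_{i,j}^{r,s,p,q}$), and for this $K$ the elements $\eta_j^{p,q}$, $1\le j\le\ell$, $1\le p<q\le n_j$, form a $\mathbb Z$-basis of $$\ker\big(\mathfrak a^*\colon H^2(\mathbb Z^N;\mathbb Z)\to H^2(G;\mathbb Z)\big).$$ -/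

import Mathlib

open CategoryTheory

noncomputable section

namespace AlmostDirect

/-! ### Almost-direct products of free groups -/

/-- An action of `Γ` on the free group `F_m` by `IA`-automorphisms: a homomorphism to `Aut(F_m)`
such that every element of `Γ` induces the identity on `H₁(F_m; ℤ) = F_m / [F_m, F_m]`. -/
def IAAction (Γ : Type) [Group Γ] (m : ℕ) : Type :=
  {φ : Γ →* MulAut (FreeGroup (Fin m)) //
    ∀ (g : Γ) (f : FreeGroup (Fin m)), Abelianization.of (φ g f) = Abelianization.of f}

/-- Simultaneous recursion on `ℓ`: the type of all iterated actions that define an almost-direct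
product of free groups of ranks `n 0, …, n (ℓ - 1)`, and the group that each of them defines.
For `ℓ = 0` the group is trivial; one more factor `F_m` is added by choosing an `IA`-action of the
group `Γ` built so far on `F_m` and passing to the semidirect product `F_m ⋊ Γ`. -/
def towerAux : (ℓ : ℕ) → (Fin ℓ → ℕ) → (T : Type) × (T → GrpCat.{0})
  | 0, _ => ⟨Unit, fun _ => GrpCat.of Unit⟩
  | ℓ + 1, n =>
    let prev := towerAux ℓ (fun i => n i.castSucc)
    ⟨(t : prev.1) × IAAction (prev.2 t) (n (Fin.last ℓ)),
      fun t => GrpCat.of (FreeGroup (Fin (n (Fin.last ℓ))) ⋊[t.2.1] prev.2 t.1)⟩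

/-- The data `(α_2, …, α_ℓ)` of an almost-direct product of free groups of ranks `n`. -/
def Tower {ℓ : ℕ} (n : Fin ℓ → ℕ) : Type := (towerAux ℓ n).1

/-- The almost-direct product `G = F_{n_ℓ} ⋊ (F_{n_{ℓ-1}} ⋊ (⋯ ⋊ F_{n_1}))` defined by `t`.
In Mathlib's semidirect product `g * f * g⁻¹ = φ g f` for `g ∈ Γ` and `f ∈ F_m`, so the right action
`α(g)(f) = g⁻¹ * f * g` is `φ g⁻¹`. -/
def Tower.Grp {ℓ : ℕ} {n : Fin ℓ → ℕ} (t : Tower n) : Type := (towerAux ℓ n).2 t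

instance Tower.instGroup {ℓ : ℕ} {n : Fin ℓ → ℕ} (t : Tower n) : Group t.Grp :=
  inferInstanceAs (Group ((towerAux ℓ n).2 t))

/-- The inclusion of the `i`-th free factor `F_{n_i}` in `G`. -/
def Tower.incl : {ℓ : ℕ} → {n : Fin ℓ → ℕ} → (t : Tower n) → (i : Fin ℓ) →
    FreeGroup (Fin (n i)) →* t.Grp
  | 0, _, _, i => i.elim0
  | _ + 1, n, t, i =>
    Fin.lastCases (motive := fun i => FreeGroup (Fin (n i)) →* t.Grp)
      (SemidirectProduct.inl (φ := t.2.1))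
      (fun i => (SemidirectProduct.inr (φ := t.2.1)).comp
        (Tower.incl (n := fun i => n i.castSucc) t.1 i)) i

/-- The generator `x_{i,p}` of `G`. -/
def Tower.x {ℓ : ℕ} {n : Fin ℓ → ℕ} (t : Tower n) (i : Fin ℓ) (p : Fin (n i)) : t.Grp :=
  t.incl i (FreeGroup.of p)

/-- The index set of all generators `x_{i,p}`; it has `N = n_1 + ⋯ + n_ℓ` elements. -/
abbrev Gen {ℓ : ℕ} (n : Fin ℓ → ℕ) : Type := (i : Fin ℓ) × Fin (n i)

theorem lift_comp_IA {m : ℕ} {A : Type} [CommGroup A] {Γ : Type} [Group Γ] (φ : IAAction Γ m)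
    (f : Fin m → A) (g : Γ) (y : FreeGroup (Fin m)) :
    FreeGroup.lift f (φ.1 g y) = FreeGroup.lift f y := by
  have h := congrArg (Abelianization.lift (FreeGroup.lift f)) (φ.2 g y)
  simpa using h

/-- The homomorphism from `G` to a commutative group with prescribed values on the generators. -/
def Tower.liftComm : {ℓ : ℕ} → {n : Fin ℓ → ℕ} → (t : Tower n) → {A : Type} → [CommGroup A] →
    ((i : Fin ℓ) → Fin (n i) → A) → t.Grp →* A
  | 0, _, _, _, _, _ => 1
  | ℓ + 1, n, t, _, _, f =>
    SemidirectProduct.lift (φ := t.2.1) (FreeGroup.lift (f (Fin.last ℓ)))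
      (Tower.liftComm (n := fun i => n i.castSucc) t.1 (fun i => f i.castSucc)) (by
        intro g
        ext y
        simpa using! lift_comp_IA t.2 (f (Fin.last ℓ)) g (FreeGroup.of y))

theorem Tower.liftComm_incl : {ℓ : ℕ} → {n : Fin ℓ → ℕ} → (t : Tower n) → {A : Type} →
    [CommGroup A] → (f : (i : Fin ℓ) → Fin (n i) → A) → (i : Fin ℓ) → (w : FreeGroup (Fin (n i))) →
    t.liftComm f (t.incl i w) = FreeGroup.lift (f i) w
  | 0, _, _, _, _, _, i, _ => i.elim0
  | ℓ + 1, n, t, _, _, f, i, w => by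
    revert w
    refine Fin.lastCases (motive := fun i => ∀ w : FreeGroup (Fin (n i)),
      t.liftComm f (t.incl i w) = FreeGroup.lift (f i) w) ?_ (fun i => ?_) i
    · intro w
      have h : t.incl (Fin.last ℓ) w = SemidirectProduct.inl (φ := t.2.1) w :=
        congrArg (fun F : FreeGroup (Fin (n (Fin.last ℓ))) →* t.Grp => F w) (Fin.lastCases_last ..)
      rw [h]
      exact SemidirectProduct.lift_inl (φ := t.2.1) ..
    · intro w
      have h : t.incl i.castSucc w = SemidirectProduct.inr (φ := t.2.1)
          (Tower.incl (n := fun i => n i.castSucc) t.1 i w) :=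
        congrArg (fun F : FreeGroup (Fin (n i.castSucc)) →* t.Grp => F w)
          (Fin.lastCases_castSucc (motive := fun i => FreeGroup (Fin (n i)) →* t.Grp) i)
      rw [h]
      refine (SemidirectProduct.lift_inr (φ := t.2.1) ..).trans ?_
      exact Tower.liftComm_incl (n := fun i => n i.castSucc) t.1 (fun i => f i.castSucc) i w

/-- The group `ℤ^N`, written multiplicatively, with one coordinate for each generator. -/
abbrev ZN {ℓ : ℕ} (n : Fin ℓ → ℕ) : Type := Multiplicative (Gen n → ℤ)

/-- The map `𝔞 : G → ℤ^N` that sends `x_{i,p}` to the standard generator `t_{i,p}`. -/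
def Tower.ab {ℓ : ℕ} {n : Fin ℓ → ℕ} (t : Tower n) : t.Grp →* ZN n :=
  t.liftComm fun i p => Multiplicative.ofAdd (Pi.single (⟨i, p⟩ : Gen n) 1)

theorem Tower.ab_x {ℓ : ℕ} {n : Fin ℓ → ℕ} (t : Tower n) (i : Fin ℓ) (p : Fin (n i)) :
    t.ab (t.x i p) = Multiplicative.ofAdd (Pi.single (⟨i, p⟩ : Gen n) 1) := by
  rw [Tower.ab, Tower.x, Tower.liftComm_incl, FreeGroup.lift_apply_of]

/-! ### Fox calculus -/

/-- The affine permutation `m ↦ x m + e_x` of `(ℤF)^X`. -/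
def foxAffine {X : Type} [DecidableEq X] (x : X) :
    Equiv.Perm (X → MonoidAlgebra ℤ (FreeGroup X)) where
  toFun m := fun y => MonoidAlgebra.single (FreeGroup.of x) 1 * m y + (Pi.single x 1 : X → MonoidAlgebra ℤ (FreeGroup X)) y
  invFun m := fun y => MonoidAlgebra.single (FreeGroup.of x)⁻¹ 1 * (m y - (Pi.single x 1 : X → MonoidAlgebra ℤ (FreeGroup X)) y)
  left_inv m := by
    funext y
    beta_reduce
    rw [add_sub_cancel_right, ← mul_assoc, MonoidAlgebra.single_mul_single, inv_mul_cancel, mul_one,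
      ← MonoidAlgebra.one_def, one_mul]
  right_inv m := by
    funext y
    beta_reduce
    rw [← mul_assoc, MonoidAlgebra.single_mul_single, mul_inv_cancel, mul_one,
      ← MonoidAlgebra.one_def, one_mul, sub_add_cancel]

/-- The Fox gradient `∇w = (∂w/∂x)_x` of a word `w` in the free group on `X`: the words act on
`(ℤF)^X` by affine maps, `x` by `m ↦ x m + e_x`, and `∇w` is the image of the origin under `w`. -/
def fox {X : Type} [DecidableEq X] (w : FreeGroup X) : X → MonoidAlgebra ℤ (FreeGroup X) :=
  FreeGroup.lift (foxAffine (X := X)) w 0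

theorem lift_foxAffine {X : Type} [DecidableEq X] (w : FreeGroup X)
    (m : X → MonoidAlgebra ℤ (FreeGroup X)) (y : X) :
    FreeGroup.lift (foxAffine (X := X)) w m y = MonoidAlgebra.single w 1 * m y + fox w y := by
  induction w using FreeGroup.induction_on generalizing m with
  | C1 => simp [fox, ← MonoidAlgebra.one_def]
  | of x => simp [fox, foxAffine]
  | inv_of x _ =>
    simp [fox, foxAffine, Equiv.Perm.inv_def, sub_eq_add_neg, mul_add]
  | mul u v hu hv =>
    simp only [fox, map_mul, Equiv.Perm.mul_apply] at *
    rw [hu, hv, hu (FreeGroup.lift foxAffine v 0)]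
    simp [mul_add, ← mul_assoc, MonoidAlgebra.single_mul_single, add_assoc]

/-- The product rule of Fox calculus. -/
theorem fox_mul {X : Type} [DecidableEq X] (u v : FreeGroup X) (y : X) :
    fox (u * v) y = fox u y + MonoidAlgebra.single u 1 * fox v y := by
  have h := lift_foxAffine u (fox v) y
  rw [add_comm, ← h]
  simp [fox]

theorem fox_of {X : Type} [DecidableEq X] (x y : X) :
    fox (FreeGroup.of x) y = (Pi.single x 1 : X → MonoidAlgebra ℤ (FreeGroup X)) y := by
  simp [fox, foxAffine]

/-- The augmentation `ε : ℤF → ℤ`. It factors through the group ring of the abelianization. -/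
def aug {X : Type} : MonoidAlgebra ℤ (FreeGroup X) →+* ℤ :=
  (MonoidAlgebra.lift ℤ ℤ (FreeGroup X) (1 : FreeGroup X →* ℤ)).toRingHom

/-! ### The commutator presentation and the matrices `A` and `B` -/

/-- The relations of `G` in commutator form: for `i < j` an expression of the word
`w = x_{j,q}⁻¹ * α_j(x_{i,p})(x_{j,q})` in the generators `x_{j,1}, …, x_{j,n_j}` as a product of
commutators `[u_1, v_1] ⋯ [u_m, v_m]`, where `[u, v] = u * v * u⁻¹ * v⁻¹`, so that `x_{j,q} * x_{i,p} = x_{i,p} * x_{j,q} * w` in `G`. -/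
structure CommutatorPresentation {ℓ : ℕ} {n : Fin ℓ → ℕ} (t : Tower n) where
  /-- The list `(u_1, v_1), …, (u_m, v_m)`. -/
  pairs : (i j : Fin ℓ) → i < j → Fin (n i) → (q : Fin (n j)) →
    List (FreeGroup (Fin (n j)) × FreeGroup (Fin (n j)))
  rel : ∀ (i j : Fin ℓ) (h : i < j) (p : Fin (n i)) (q : Fin (n j)),
    t.x j q * t.x i p =
      t.x i p * t.x j q * t.incl j (((pairs i j h p q).map fun uv => uv.1 * uv.2 * uv.1⁻¹ * uv.2⁻¹).prod)

/-- Indices `(i, j, p, q)` with `i < j`, for the relations of `G` and for the products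
`e_{i,p} e_{j,q}` of generators from different factors. -/
abbrev Mixed {ℓ : ℕ} (n : Fin ℓ → ℕ) : Type :=
  (ij : {ij : Fin ℓ × Fin ℓ // ij.1 < ij.2}) × (Fin (n ij.1.1) × Fin (n ij.1.2))

/-- Indices `(j, p, q)` with `p < q`, for the products `e_{j,p} e_{j,q}`. -/
abbrev Diag {ℓ : ℕ} (n : Fin ℓ → ℕ) : Type :=
  (j : Fin ℓ) × {pq : Fin (n j) × Fin (n j) // pq.1 < pq.2}

/-- A word in `x_{j,1}, …, x_{j,n_j}` as a word in all generators, that is, in `F_N`. -/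
def toFN {ℓ : ℕ} {n : Fin ℓ → ℕ} (j : Fin ℓ) (w : FreeGroup (Fin (n j))) : FreeGroup (Gen n) :=
  FreeGroup.map (fun p => (⟨j, p⟩ : Gen n)) w

/-- The coefficient of `e_a e_b` in the element `ε(∇u) ε(∇v)` of the exterior algebra. -/
def foxMinor {X : Type} [DecidableEq X] (u v : FreeGroup X) (a b : X) : ℤ :=
  aug (fox u a) * aug (fox v b) - aug (fox u b) * aug (fox v a)

/-- The matrix whose blocks are the `C_{i,j}`: the entry `c_{i,j}^{p,q,r,s}` in the row of the
relation `(i, j, p, q)` and the column of `e_{j,r} e_{j,s}`, `r < s`, is the coefficient of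
`e_{j,r} e_{j,s}` in `∑_k ε(∇u_k) ε(∇v_k)`. (The entries with column index `e_{j',r} e_{j',s}`,
`j' ≠ j`, vanish, as `u_k` and `v_k` are words in `x_{j,1}, …, x_{j,n_j}`.) -/
def CommutatorPresentation.C {ℓ : ℕ} {n : Fin ℓ → ℕ} {t : Tower n}
    (D : CommutatorPresentation t) : Matrix (Mixed n) (Diag n) ℤ :=
  Matrix.of fun ρ σ =>
    ((D.pairs ρ.1.1.1 ρ.1.1.2 ρ.1.2 ρ.2.1 ρ.2.2).map fun uv =>
      foxMinor (toFN (n := n) ρ.1.1.2 uv.1) (toFN (n := n) ρ.1.1.2 uv.2)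
        ⟨σ.1, σ.2.1.1⟩ ⟨σ.1, σ.2.1.2⟩).sum

/-- The matrix `A = (I | C)` of `𝔞_* : H₂(G; ℤ) → H₂(ℤ^N; ℤ)`, columns grouped by type. -/
def CommutatorPresentation.A {ℓ : ℕ} {n : Fin ℓ → ℕ} {t : Tower n}
    (D : CommutatorPresentation t) : Matrix (Mixed n) (Mixed n ⊕ Diag n) ℤ :=
  Matrix.fromCols 1 D.C

/-- The matrix `B` with the blocks `K` and `I`. -/
def matB {ℓ : ℕ} {n : Fin ℓ → ℕ} (K : Matrix (Mixed n) (Diag n) ℤ) :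
    Matrix (Mixed n ⊕ Diag n) (Diag n) ℤ :=
  Matrix.fromRows K 1

/-! ### Second cohomology with integral coefficients -/

/-- `H²(Γ; ℤ)`, trivial coefficients. -/
abbrev H2Z (Γ : Type) [Group Γ] : Type := groupCohomology (Rep.trivial ℤ Γ ℤ) 2

/-- `f^* : H²(Γ'; ℤ) → H²(Γ; ℤ)`. -/
def H2Z.pullback {Γ Γ' : Type} [Group Γ] [Group Γ'] (f : Γ →* Γ') : H2Z Γ' →ₗ[ℤ] H2Z Γ :=
  (groupCohomology.map (A := Rep.trivial ℤ Γ' ℤ) (B := Rep.trivial ℤ Γ ℤ) f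
    (𝟙 (Rep.trivial ℤ Γ ℤ)) 2).hom

/-- The cup product `χ ψ ∈ H²(Γ; ℤ)` of two classes in `H¹(Γ; ℤ) = Hom(Γ, ℤ)`: the class of the
cocycle `(g, h) ↦ χ(g) ψ(h)`. -/
def cup {Γ : Type} [Group Γ] (χ ψ : Γ →* Multiplicative ℤ) : H2Z Γ :=
  groupCohomology.H2π (Rep.trivial ℤ Γ ℤ)
    ⟨fun gh => (χ gh.1).toAdd * (ψ gh.2).toAdd, by
      rw [groupCohomology.mem_cocycles₂_iff]
      intro g h j
      change ((χ (g * h)).toAdd * (ψ j).toAdd + (χ g).toAdd * (ψ h).toAdd : ℤ) =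
        (χ h).toAdd * (ψ j).toAdd + (χ g).toAdd * (ψ (h * j)).toAdd
      simp only [map_mul, toAdd_mul]
      ring⟩

/-- The class `e_a ∈ H¹(ℤ^N; ℤ) = Hom(ℤ^N, ℤ)` dual to the generator `t_a`. -/
def e {ℓ : ℕ} {n : Fin ℓ → ℕ} (a : Gen n) : ZN n →* Multiplicative ℤ :=
  AddMonoidHom.toMultiplicative (Pi.evalAddMonoidHom (fun _ : Gen n => ℤ) a)

/-- The element
`η_j^{p,q} = e_{j,p} e_{j,q} + ∑_{i<j} ∑_r ∑_s κ_{i,j}^{p,q,r,s} e_{i,r} e_{j,s}` of `H²(ℤ^N; ℤ)`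
given by the column `(j, p, q)` of the matrix `K`. -/
def eta {ℓ : ℕ} {n : Fin ℓ → ℕ} (K : Matrix (Mixed n) (Diag n) ℤ) (σ : Diag n) : H2Z (ZN n) :=
  cup (e ⟨σ.1, σ.2.1.1⟩) (e ⟨σ.1, σ.2.1.2⟩) +
    ∑ i : {i : Fin ℓ // i < σ.1}, ∑ r : Fin (n i.1), ∑ s : Fin (n σ.1),
      K ⟨⟨(i.1, σ.1), i.2⟩, (r, s)⟩ σ • cup (e (⟨i.1, r⟩ : Gen n)) (e (⟨σ.1, s⟩ : Gen n))

end AlmostDirect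

end

/-! A class in $H^2(\mathbb Z^N;\mathbb Z)$ is a central extension $E$ of $\mathbb Z^N$ by $\mathbb
Z$, and $\mathfrak a^*$ kills it exactly when $\mathfrak a$ lifts to a homomorphism $G\to E$
(`H2Z.pullback_H2π_eq_zero_iff`). Commutators in $E$ are central and depend only on the images in
$\mathbb Z^N$. The resulting pairing at pairs of standard generators determines the class
(`mk_eq_zero_of_alt`), so a class amounts to its coordinates $m$ on the $e_{i,p}e_{j,q}$, $i<j$, and
$d$ on the $e_{j,p}e_{j,q}$, $p<q$.

The relations $x_{j,q}x_{i,p}=x_{i,p}x_{j,q}w$ present $G$ (`Tower.exists_lift`), so $\mathfrak a$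
lifts iff lifts of the generators satisfy them in $E$. In the relation $\rho$, interchanging the two
lifts costs the central element $-m_\rho$. The word $w=\prod_k[u_k,v_k]$ maps to the sum of the
pairings of the $u_k,v_k$. Augmented Fox derivatives are exponent sums, so this sum is $(Cd)_\rho$
(`sum_alt_pairs`).

Hence $\ker\mathfrak a^*$ is the graph $m=-Cd$ (`pullback_ab_eq_zero_iff`). The $\eta$ with $K=-C$
are the points of this graph over the standard basis of the $d$-space. The matrix equation is
immediate from $AB_K=K+C$. -/

noncomputable section

namespace AlmostDirect

/-! ### Central extensions defined by integral 2-cocycles -/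

/-- Integral 2-cocycles on `Γ`, trivial coefficients. -/
abbrev Z2 (Γ : Type) [Group Γ] : Type := groupCohomology.cocycles₂ (Rep.trivial ℤ Γ ℤ)

/-- The value of a cocycle, as an integer. -/
def Z2.eval {Γ : Type} [Group Γ] (f : Z2 Γ) (g h : Γ) : ℤ := f (g, h)

theorem Z2.eval_mul {Γ : Type} [Group Γ] (f : Z2 Γ) (g h j : Γ) :
    f.eval (g * h) j + f.eval g h = f.eval h j + f.eval g (h * j) :=
  (groupCohomology.mem_cocycles₂_iff (A := Rep.trivial ℤ Γ ℤ) f).1 f.2 g h j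

theorem Z2.eval_one_left {Γ : Type} [Group Γ] (f : Z2 Γ) (g : Γ) : f.eval 1 g = f.eval 1 1 := by
  have h := f.eval_mul 1 1 g
  simp only [one_mul] at h
  linarith

theorem Z2.eval_one_right {Γ : Type} [Group Γ] (f : Z2 Γ) (g : Γ) : f.eval g 1 = f.eval 1 1 := by
  have h := f.eval_mul g 1 1
  simp only [mul_one] at h
  linarith

/-- The central extension of `Γ` by `ℤ` defined by a cocycle. -/
@[ext]
structure CocycleExt {Γ : Type} [Group Γ] (f : Z2 Γ) where
  /-- The central coordinate. -/
  z : ℤ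
  /-- The image in `Γ`. -/
  g : Γ

namespace CocycleExt

variable {Γ : Type} [Group Γ] {f : Z2 Γ}

instance : Mul (CocycleExt f) := ⟨fun a b => ⟨a.z + b.z + f.eval a.g b.g, a.g * b.g⟩⟩

-- Cocycles are not assumed normalized, so the identity carries the correction $-f(1,1)$; the same
-- shift enters inverses and `central`.
instance : One (CocycleExt f) := ⟨⟨-f.eval 1 1, 1⟩⟩

instance : Inv (CocycleExt f) := ⟨fun a => ⟨-a.z - f.eval a.g⁻¹ a.g - f.eval 1 1, a.g⁻¹⟩⟩

@[simp] theorem mul_z (a b : CocycleExt f) : (a * b).z = a.z + b.z + f.eval a.g b.g := rfl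
@[simp] theorem mul_g (a b : CocycleExt f) : (a * b).g = a.g * b.g := rfl
@[simp] theorem one_z : (1 : CocycleExt f).z = -f.eval 1 1 := rfl
@[simp] theorem one_g : (1 : CocycleExt f).g = 1 := rfl
@[simp] theorem inv_z (a : CocycleExt f) : a⁻¹.z = -a.z - f.eval a.g⁻¹ a.g - f.eval 1 1 := rfl
@[simp] theorem inv_g (a : CocycleExt f) : a⁻¹.g = a.g⁻¹ := rfl

instance : Group (CocycleExt f) :=
  Group.ofLeftAxioms
    (fun a b c => by
      ext
      · have h := f.eval_mul a.g b.g c.g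
        simp only [mul_z, mul_g]
        linarith
      · exact mul_assoc _ _ _)
    (fun a => by
      ext
      · have h := f.eval_one_left a.g
        simp only [mul_z, one_z, one_g]
        linarith
      · exact one_mul _)
    (fun a => by
      ext
      · simp only [mul_z, one_z, inv_z, inv_g]
        linarith
      · exact inv_mul_cancel _)

/-- The projection of the extension to `Γ`. -/
def proj (f : Z2 Γ) : CocycleExt f →* Γ where
  toFun := g
  map_one' := rfl
  map_mul' _ _ := rfl

@[simp] theorem proj_apply (a : CocycleExt f) : proj f a = a.g := rfl

/-- The inclusion of the centre `ℤ` in the extension. -/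
def central (f : Z2 Γ) : Multiplicative ℤ →* CocycleExt f where
  toFun m := ⟨m.toAdd - f.eval 1 1, 1⟩
  map_one' := by ext <;> simp
  map_mul' a b := by
    ext
    · simp only [toAdd_mul, mul_z]
      ring
    · simp

@[simp] theorem central_g (m : Multiplicative ℤ) : (central f m).g = 1 := rfl
@[simp] theorem central_z (m : Multiplicative ℤ) : (central f m).z = m.toAdd - f.eval 1 1 := rfl

theorem central_mul_comm (m : Multiplicative ℤ) (a : CocycleExt f) :
    central f m * a = a * central f m := by
  ext
  · simp only [mul_z, central_g, central_z, f.eval_one_left a.g, f.eval_one_right a.g]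
    ring
  · simp

theorem central_injective : Function.Injective (central f) := fun a b h => by
  have := congrArg CocycleExt.z h
  simpa using this

end CocycleExt

/-- The negative of the central coordinate of a lift is a 1-cochain with coboundary $a^*f$, and
conversely any such cochain defines a lift. -/
theorem H2Z.pullback_H2π_eq_zero_iff {Γ Γ' : Type} [Group Γ] [Group Γ'] (a : Γ →* Γ') (f : Z2 Γ') :
    H2Z.pullback a (groupCohomology.H2π (Rep.trivial ℤ Γ' ℤ) f) = 0 ↔
      ∃ s : Γ →* CocycleExt f, ∀ g, (s g).g = a g := by
  have key : H2Z.pullback a (groupCohomology.H2π (Rep.trivial ℤ Γ' ℤ) f) =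
      groupCohomology.H2π (Rep.trivial ℤ Γ ℤ) (groupCohomology.mapCocycles₂
        (A := Rep.trivial ℤ Γ' ℤ) (B := Rep.trivial ℤ Γ ℤ) a (𝟙 (Rep.trivial ℤ Γ ℤ)) f) :=
    groupCohomology.H2π_comp_map_apply (A := Rep.trivial ℤ Γ' ℤ) (B := Rep.trivial ℤ Γ ℤ) a
      (𝟙 (Rep.trivial ℤ Γ ℤ)) f
  rw [key, groupCohomology.H2π_eq_zero_iff]
  constructor
  · rintro ⟨h, hh⟩
    have hh' : ∀ g k : Γ, (h k - h (g * k) + h g : ℤ) = f.eval (a g) (a k) :=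
      fun g k => congrFun hh (g, k)
    refine ⟨MonoidHom.mk' (fun g => ⟨-(h g : ℤ), a g⟩) fun g k => ?_, fun g => rfl⟩
    ext
    · have := hh' g k
      simp only [CocycleExt.mul_z]
      linarith
    · simp
  · rintro ⟨s, hs⟩
    refine ⟨fun g => (-(s g).z : ℤ), ?_⟩
    funext ⟨g, k⟩
    change (-(s k).z - -(s (g * k)).z + -(s g).z : ℤ) = f.eval (a g) (a k)
    rw [map_mul, CocycleExt.mul_z, hs, hs]
    ring

theorem H2π_eq_zero_of_section {Γ : Type} [Group Γ] (f : Z2 Γ) (s : Γ →* CocycleExt f)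
    (hs : ∀ g, (s g).g = g) : groupCohomology.H2π (Rep.trivial ℤ Γ ℤ) f = 0 := by
  rw [groupCohomology.H2π_eq_zero_iff]
  refine ⟨fun g => (-(s g).z : ℤ), ?_⟩
  funext ⟨g, k⟩
  change (-(s k).z - -(s (g * k)).z + -(s g).z : ℤ) = f.eval g k
  rw [map_mul, CocycleExt.mul_z, hs, hs]
  ring

/-! ### The commutator pairing of a class on a commutative group -/

section Pairing

variable {Γ : Type} [CommGroup Γ]

/-- `f ↦ f(u, v) - f(v, u)` on cocycles. -/
def Z2.alt (u v : Γ) : Z2 Γ →ₗ[ℤ] ℤ where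
  toFun f := f.eval u v - f.eval v u
  map_add' f f' := by
    change ((f.eval u v + f'.eval u v) - (f.eval v u + f'.eval v u) : ℤ) = _
    ring
  map_smul' m f := by
    change (m * f.eval u v - m * f.eval v u : ℤ) = m * _
    ring

theorem Z2.alt_apply (u v : Γ) (f : Z2 Γ) : Z2.alt u v f = f.eval u v - f.eval v u := rfl

/-- Since `Γ` is commutative, $ab$ and $ba$ lie over the same element and can differ only by a
central one. -/
theorem CocycleExt.mul_eq_central {f : Z2 Γ} (a b : CocycleExt f) :
    a * b = central f (.ofAdd (Z2.alt a.g b.g f)) * (b * a) := by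
  ext
  · simp only [mul_z, mul_g, central_z, central_g, f.eval_one_left, Z2.alt_apply, toAdd_ofAdd]
    ring
  · simp [mul_comm]

theorem CocycleExt.commutator_eq_central {f : Z2 Γ} (a b : CocycleExt f) :
    a * b * a⁻¹ * b⁻¹ = central f (.ofAdd (Z2.alt a.g b.g f)) := by
  rw [mul_eq_central a b]
  group

/-- The epimorphism from cocycles to classes, as a linear map. -/
def H2Z.mk (Γ : Type) [Group Γ] : Z2 Γ →ₗ[ℤ] H2Z Γ :=
  (groupCohomology.H2π (Rep.trivial ℤ Γ ℤ)).hom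

theorem H2Z.mk_surjective (Γ : Type) [Group Γ] : Function.Surjective (H2Z.mk Γ) :=
  (ModuleCat.epi_iff_surjective _).1
    (inferInstanceAs (Epi (groupCohomology.H2π (Rep.trivial ℤ Γ ℤ))))

/-- On a commutative group the coboundary $h(k)-h(gk)+h(g)$ is symmetric in $g$ and $k$, so
antisymmetrization descends to classes. -/
theorem Z2.alt_eq_zero_of_mk (u v : Γ) :
    LinearMap.ker (H2Z.mk Γ) ≤ LinearMap.ker (Z2.alt u v) := by
  intro f hf
  obtain ⟨h, hh⟩ := (groupCohomology.H2π_eq_zero_iff f).1 hf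
  have hh' : ∀ g k : Γ, (h k - h (g * k) + h g : ℤ) = f.eval g k :=
    fun g k => congrFun hh (g, k)
  rw [LinearMap.mem_ker, Z2.alt_apply, ← hh' u v, ← hh' v u, mul_comm v u]
  ring

/-- The commutator pairing `H²(Γ; ℤ) → ℤ` at `u` and `v`. -/
def H2Z.alt (u v : Γ) : H2Z Γ →ₗ[ℤ] ℤ :=
  (LinearMap.ker (H2Z.mk Γ)).liftQ (Z2.alt u v) (Z2.alt_eq_zero_of_mk u v) ∘ₗ
    ((H2Z.mk Γ).quotKerEquivOfSurjective (H2Z.mk_surjective Γ)).symm.toLinearMap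

theorem H2Z.alt_mk (u v : Γ) (f : Z2 Γ) : H2Z.alt u v (H2Z.mk Γ f) = Z2.alt u v f := by
  have h : ((H2Z.mk Γ).quotKerEquivOfSurjective (H2Z.mk_surjective Γ)).symm (H2Z.mk Γ f) =
      Submodule.Quotient.mk f := by
    rw [LinearEquiv.symm_apply_eq]
    rfl
  simp only [H2Z.alt, LinearMap.comp_apply, LinearEquiv.coe_coe, h]
  rfl

theorem H2Z.alt_cup (u v : Γ) (χ ψ : Γ →* Multiplicative ℤ) :
    H2Z.alt u v (cup χ ψ) =
      (χ u).toAdd * (ψ v).toAdd - (χ v).toAdd * (ψ u).toAdd :=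
  H2Z.alt_mk u v _

theorem H2Z.alt_swap (u v : Γ) (x : H2Z Γ) : H2Z.alt v u x = -H2Z.alt u v x := by
  obtain ⟨f, rfl⟩ := H2Z.mk_surjective Γ x
  simp [H2Z.alt_mk, Z2.alt_apply]

theorem H2Z.alt_self (u : Γ) (x : H2Z Γ) : H2Z.alt u u x = 0 := by
  obtain ⟨f, rfl⟩ := H2Z.mk_surjective Γ x
  simp [H2Z.alt_mk, Z2.alt_apply]

end Pairing

/-! ### Classes on a free abelian group -/

/-- Vanishing of the pairing makes lifts of the basis vectors commute. They then define a
homomorphism from the product of the infinite cyclic groups that they lift, which splits the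
extension. -/
theorem mk_eq_zero_of_alt {ι : Type} [Fintype ι] [DecidableEq ι]
    (x : H2Z (Multiplicative (ι → ℤ)))
    (hx : ∀ a b : ι, H2Z.alt (.ofAdd (Pi.single a 1)) (.ofAdd (Pi.single b 1)) x = 0) : x = 0 := by
  obtain ⟨f, rfl⟩ := H2Z.mk_surjective _ x
  let y : ι → CocycleExt f := fun a => ⟨0, .ofAdd (Pi.single a 1)⟩
  have hy : ∀ a b, Commute (y a) (y b) := fun a b => by
    have h := CocycleExt.mul_eq_central (y a) (y b)
    have h0 : Z2.alt (y a).g (y b).g f = 0 := by rw [← H2Z.alt_mk]; exact hx a b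
    rw [h0, ofAdd_zero, map_one, one_mul] at h
    exact h
  have hcomm : Pairwise fun a b => ∀ m k : Multiplicative ℤ,
      Commute (zpowersHom (CocycleExt f) (y a) m) (zpowersHom (CocycleExt f) (y b) k) :=
    fun a b _ m k => by
      simp only [zpowersHom_apply]
      exact (hy a b).zpow_zpow _ _
  let s₀ : (ι → Multiplicative ℤ) →* CocycleExt f :=
    MonoidHom.noncommPiCoprod (fun a => zpowersHom (CocycleExt f) (y a)) hcomm
  let c : Multiplicative (ι → ℤ) →* (ι → Multiplicative ℤ) :=
    { toFun := fun v a => .ofAdd (v.toAdd a)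
      map_one' := rfl
      map_mul' := fun _ _ => rfl }
  let d : (ι → Multiplicative ℤ) →* Multiplicative (ι → ℤ) :=
    { toFun := fun v => .ofAdd fun a => (v a).toAdd
      map_one' := rfl
      map_mul' := fun _ _ => rfl }
  have hd : (CocycleExt.proj f).comp s₀ = d := by
    refine MonoidHom.pi_ext fun a m => ?_
    simp only [MonoidHom.comp_apply, s₀, MonoidHom.noncommPiCoprod_mulSingle, zpowersHom_apply,
      map_zpow]
    simp only [CocycleExt.proj_apply, y]
    change Multiplicative.ofAdd (m.toAdd • (Pi.single a 1 : ι → ℤ)) = _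
    refine congrArg Multiplicative.ofAdd (funext fun b => ?_)
    change _ = ((Pi.mulSingle a m : ι → Multiplicative ℤ) b).toAdd
    by_cases h : b = a
    · subst h; simp
    · simp [h]
  exact H2π_eq_zero_of_section f (s₀.comp c) fun g => DFunLike.congr_fun hd (c g)

/-! ### The outermost semidirect product of a tower -/

namespace Tower

section Step

variable {ℓ : ℕ} {n : Fin (ℓ + 1) → ℕ} (t : Tower n)

/-- The tower without its last factor. -/
def pred : Tower (fun i : Fin ℓ => n i.castSucc) := t.1

/-- The action that defines the last factor. -/
def action : IAAction t.pred.Grp (n (Fin.last ℓ)) := t.2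

/-- The inclusion of the group built before the last step. -/
def inr : t.pred.Grp →* t.Grp := SemidirectProduct.inr (φ := t.2.1)

theorem inr_injective : Function.Injective t.inr := SemidirectProduct.inr_injective (φ := t.2.1)

theorem incl_last (w : FreeGroup (Fin (n (Fin.last ℓ)))) :
    t.incl (Fin.last ℓ) w = SemidirectProduct.inl (φ := t.2.1) w :=
  congrArg (fun F : FreeGroup (Fin (n (Fin.last ℓ))) →* t.Grp => F w) (Fin.lastCases_last ..)

theorem incl_castSucc (i : Fin ℓ) (w : FreeGroup (Fin (n i.castSucc))) :
    t.incl i.castSucc w = t.inr (t.pred.incl i w) :=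
  congrArg (fun F : FreeGroup (Fin (n i.castSucc)) →* t.Grp => F w)
    (Fin.lastCases_castSucc (motive := fun i => FreeGroup (Fin (n i)) →* t.Grp) i)

theorem x_castSucc (i : Fin ℓ) (p : Fin (n i.castSucc)) : t.x i.castSucc p = t.inr (t.pred.x i p) :=
  t.incl_castSucc i _

theorem exists_incl_last_mul_inr (g : t.Grp) :
    ∃ f k, t.incl (Fin.last ℓ) f * t.inr k = g := by
  refine ⟨SemidirectProduct.left (φ := t.2.1) g, SemidirectProduct.right (φ := t.2.1) g, ?_⟩
  rw [incl_last]
  exact SemidirectProduct.inl_left_mul_inr_right (φ := t.2.1) g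

theorem incl_last_action (k : t.pred.Grp) (f : FreeGroup (Fin (n (Fin.last ℓ)))) :
    t.incl (Fin.last ℓ) (t.action.1 k f) = t.inr k * t.incl (Fin.last ℓ) f * (t.inr k)⁻¹ := by
  rw [incl_last, incl_last, ← map_inv]
  exact SemidirectProduct.inl_aut (φ := t.2.1) k f

theorem incl_last_injective : Function.Injective (t.incl (Fin.last ℓ)) := fun a b h => by
  rw [incl_last, incl_last] at h
  exact SemidirectProduct.inl_injective (φ := t.2.1) h

theorem exists_lift_step {E : Type} [Group E] (a : FreeGroup (Fin (n (Fin.last ℓ))) →* E)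
    (b : t.pred.Grp →* E) (h : ∀ k f, a (t.action.1 k f) = b k * a f * (b k)⁻¹) :
    ∃ s : t.Grp →* E, (∀ f, s (t.incl (Fin.last ℓ) f) = a f) ∧ ∀ k, s (t.inr k) = b k := by
  refine ⟨SemidirectProduct.lift (φ := t.2.1) a b fun k => ?_, fun f => ?_, fun k => ?_⟩
  · ext q
    simpa using! h k (FreeGroup.of q)
  · rw [incl_last]
    exact SemidirectProduct.lift_inl (φ := t.2.1) ..
  · exact SemidirectProduct.lift_inr (φ := t.2.1) ..

end Step

/-! ### Generators and relations -/

theorem incl_mem_of_x_mem {ℓ : ℕ} {n : Fin ℓ → ℕ} (t : Tower n) (H : Subgroup t.Grp) (i : Fin ℓ)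
    (h : ∀ p, t.x i p ∈ H) (w : FreeGroup (Fin (n i))) : t.incl i w ∈ H := by
  induction w using FreeGroup.induction_on with
  | C1 => rw [map_one]; exact H.one_mem
  | of p => exact h p
  | inv_of p hp => rw [map_inv]; exact H.inv_mem hp
  | mul u v hu hv => rw [map_mul]; exact H.mul_mem hu hv

theorem eq_top_of_x_mem {ℓ : ℕ} {n : Fin ℓ → ℕ} (t : Tower n) (H : Subgroup t.Grp)
    (h : ∀ i p, t.x i p ∈ H) : H = ⊤ := by
  induction ℓ with
  | zero =>
    refine (Subgroup.eq_top_iff' H).2 fun g => ?_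
    have hg : g = 1 := Subsingleton.elim (α := Unit) g 1
    rw [hg]
    exact H.one_mem
  | succ ℓ ih =>
    refine (Subgroup.eq_top_iff' H).2 fun g => ?_
    obtain ⟨f, k, rfl⟩ := t.exists_incl_last_mul_inr g
    refine H.mul_mem (t.incl_mem_of_x_mem H _ (h _) f) ?_
    have hk := ih t.pred (H.comap t.inr) fun i p => by
      rw [Subgroup.mem_comap, ← x_castSucc]
      exact h _ p
    have : k ∈ H.comap t.inr := hk ▸ Subgroup.mem_top k
    exact this

theorem hom_ext {ℓ : ℕ} {n : Fin ℓ → ℕ} (t : Tower n) {E : Type} [Group E] {a b : t.Grp →* E}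
    (h : ∀ i p, a (t.x i p) = b (t.x i p)) : a = b := by
  have := t.eq_top_of_x_mem (a.eqLocus b) h
  ext g
  have hg : g ∈ a.eqLocus b := this ▸ Subgroup.mem_top g
  exact hg

theorem exists_relation {ℓ : ℕ} {n : Fin ℓ → ℕ} (t : Tower n) (i j : Fin ℓ) (hij : i < j)
    (p : Fin (n i)) (q : Fin (n j)) :
    ∃ w ∈ commutator (FreeGroup (Fin (n j))),
      t.x j q * t.x i p = t.x i p * t.x j q * t.incl j w := by
  induction ℓ with
  | zero => exact i.elim0
  | succ ℓ ih =>
    induction i using Fin.lastCases with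
    | last => exact absurd hij (not_lt.2 (Fin.le_last j))
    | cast i =>
      induction j using Fin.lastCases with
      | last =>
        -- This word is trivial in the abelianization because the action is by `IA`-automorphisms.
        refine ⟨(FreeGroup.of q)⁻¹ * t.action.1 (t.pred.x i p)⁻¹ (FreeGroup.of q), ?_, ?_⟩
        · rw [← Abelianization.ker_of, MonoidHom.mem_ker, map_mul, t.action.2, map_inv,
            inv_mul_cancel]
        · rw [map_mul, incl_last_action, x_castSucc, map_inv, map_inv, x]
          group
      | cast j =>
        obtain ⟨w, hw, h⟩ := ih t.pred i j (Fin.castSucc_lt_castSucc_iff.1 hij) p q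
        refine ⟨w, hw, ?_⟩
        rw [x_castSucc, x_castSucc, incl_castSucc, ← map_mul, h, map_mul, map_mul]

/-- This says that the relations present $G$. By induction on `ℓ`, a map on the smaller group
extends over the semidirect product once it is compatible with the action. The group elements for
which compatibility holds form a subgroup, so generators suffice. -/
theorem exists_lift {ℓ : ℕ} {n : Fin ℓ → ℕ} (t : Tower n)
    (W : (i j : Fin ℓ) → i < j → Fin (n i) → Fin (n j) → FreeGroup (Fin (n j)))
    (hW : ∀ i j hij p q, t.x j q * t.x i p = t.x i p * t.x j q * t.incl j (W i j hij p q))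
    {E : Type} [Group E] (y : (i : Fin ℓ) → Fin (n i) → E)
    (hy : ∀ i j hij p q,
      y j q * y i p = y i p * y j q * FreeGroup.lift (y j) (W i j hij p q)) :
    ∃ s : t.Grp →* E, ∀ i p, s (t.x i p) = y i p := by
  induction ℓ with
  | zero => exact ⟨1, fun i => i.elim0⟩
  | succ ℓ ih =>
    obtain ⟨b, hb⟩ := ih t.pred
      (fun i j hij p q => W i.castSucc j.castSucc (Fin.castSucc_lt_castSucc_iff.2 hij) p q)
      (fun i j hij p q => t.inr_injective (by
        have h := hW i.castSucc j.castSucc (Fin.castSucc_lt_castSucc_iff.2 hij) p q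
        rwa [x_castSucc, x_castSucc, incl_castSucc, ← map_mul, ← map_mul, ← map_mul] at h))
      (fun i p => y i.castSucc p) (fun i j hij p q => hy _ _ _ p q)
    have inv_of : ∀ k : t.pred.Grp,
        (∀ f, FreeGroup.lift (y (Fin.last ℓ)) (t.action.1 k f) =
          b k * FreeGroup.lift (y (Fin.last ℓ)) f * (b k)⁻¹) →
        ∀ f, FreeGroup.lift (y (Fin.last ℓ)) (t.action.1 k⁻¹ f) =
          b k⁻¹ * FreeGroup.lift (y (Fin.last ℓ)) f * (b k⁻¹)⁻¹ := fun k hk f => by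
      have h := hk (t.action.1 k⁻¹ f)
      rw [← MulAut.mul_apply, ← map_mul, mul_inv_cancel, map_one, MulAut.one_apply] at h
      rw [h, map_inv b]
      generalize FreeGroup.lift (y (Fin.last ℓ)) (t.action.1 k⁻¹ f) = z
      group
    let H : Subgroup t.pred.Grp :=
      { carrier := {k | ∀ f, FreeGroup.lift (y (Fin.last ℓ)) (t.action.1 k f) =
          b k * FreeGroup.lift (y (Fin.last ℓ)) f * (b k)⁻¹}
        one_mem' := fun f => by simp
        mul_mem' := fun {k k'} hk hk' f => by
          rw [map_mul, MulAut.mul_apply, hk, hk', map_mul]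
          group
        inv_mem' := fun {k} hk => inv_of k hk }
    have hH : H = ⊤ := t.pred.eq_top_of_x_mem H fun i p => by
      -- The relation describes conjugation by $x_{i,p}^{-1}$ as an automorphism, $x_{j,q}\mapsto
      -- x_{j,q}w$, so compatibility is checked for the inverse of the generator.
      refine inv_inv (t.pred.x i p) ▸ H.inv_mem fun f => ?_
      refine DFunLike.congr_fun (f := (FreeGroup.lift (y (Fin.last ℓ))).comp
        (t.action.1 (t.pred.x i p)⁻¹).toMonoidHom) (g := (MulAut.conj (b (t.pred.x i p)⁻¹)
        ).toMonoidHom.comp (FreeGroup.lift (y (Fin.last ℓ)))) (FreeGroup.ext_hom _ _ fun q => ?_) f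
      have hq : t.action.1 (t.pred.x i p)⁻¹ (FreeGroup.of q) =
          FreeGroup.of q * W i.castSucc (Fin.last ℓ) (Fin.castSucc_lt_last i) p q := by
        apply t.incl_last_injective
        have h := hW i.castSucc (Fin.last ℓ) (Fin.castSucc_lt_last i) p q
        rw [x_castSucc, mul_assoc, ← inv_mul_eq_iff_eq_mul] at h
        rw [incl_last_action, map_mul, map_inv, inv_inv, mul_assoc]
        exact h
      have h := hy i.castSucc (Fin.last ℓ) (Fin.castSucc_lt_last i) p q
      change FreeGroup.lift (y (Fin.last ℓ)) (t.action.1 (t.pred.x i p)⁻¹ (FreeGroup.of q)) =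
        b (t.pred.x i p)⁻¹ * FreeGroup.lift (y (Fin.last ℓ)) (FreeGroup.of q) *
          (b (t.pred.x i p)⁻¹)⁻¹
      rw [hq, map_mul, FreeGroup.lift_apply_of, map_inv, inv_inv, hb, mul_assoc _ (y _ q), h]
      group
    obtain ⟨s, hs, hs'⟩ := t.exists_lift_step (FreeGroup.lift (y (Fin.last ℓ))) b fun k => by
      have hk : k ∈ H := hH ▸ Subgroup.mem_top k
      exact hk
    refine ⟨s, fun i p => ?_⟩
    induction i using Fin.lastCases with
    | last => rw [x, hs, FreeGroup.lift_apply_of]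
    | cast i => rw [x_castSucc, hs', hb]

/-! ### The abelianization -/

theorem ab_surjective {ℓ : ℕ} {n : Fin ℓ → ℕ} (t : Tower n) : Function.Surjective t.ab := by
  intro v
  have hv : v = ∏ a : Gen n, t.ab (t.x a.1 a.2) ^ (v.toAdd a) := by
    apply Multiplicative.toAdd.injective
    funext b
    simp only [ab_x, toAdd_prod, toAdd_zpow, toAdd_ofAdd, Finset.sum_apply, Pi.smul_apply]
    rw [Finset.sum_eq_single b]
    · simp
    · intro a _ hab
      simp [Pi.single_eq_of_ne hab.symm]
    · simp
  rw [hv]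
  exact ⟨(Finset.univ.toList.map fun a : Gen n => t.x a.1 a.2 ^ (v.toAdd a)).prod, by
    simp [map_list_prod, Function.comp_def]⟩

theorem ker_ab {ℓ : ℕ} {n : Fin ℓ → ℕ} (t : Tower n) : t.ab.ker = commutator t.Grp := by
  apply le_antisymm
  -- The abelianization map factors through `t.ab` via `s`, which forces the kernel into the
  -- commutator subgroup.
  · let s : ZN n →* Abelianization t.Grp :=
      { toFun := fun v => ∏ a : Gen n, Abelianization.of (t.x a.1 a.2) ^ (v.toAdd a)
        map_one' := by simp
        map_mul' := fun u v => by
          simp only [toAdd_mul, Pi.add_apply, zpow_add, Finset.prod_mul_distrib] }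
    have hs : s.comp t.ab = Abelianization.of := t.hom_ext fun i p => by
      rw [MonoidHom.comp_apply, ab_x]
      change ∏ a : Gen n, Abelianization.of (t.x a.1 a.2) ^ ((Pi.single ⟨i, p⟩ 1 : Gen n → ℤ) a) = _
      rw [Finset.prod_eq_single (⟨i, p⟩ : Gen n)]
      · simp
      · intro a _ hab
        simp [Pi.single_eq_of_ne hab]
      · simp
    intro g hg
    rw [← Abelianization.ker_of, ← hs, MonoidHom.mem_ker, MonoidHom.comp_apply, hg, map_one]
  · exact Abelianization.commutator_subset_ker t.ab

end Tower

theorem exists_prod_commutators {F : Type} [Group F] {w : F} (hw : w ∈ commutator F) :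
    ∃ l : List (F × F), (l.map fun uv => uv.1 * uv.2 * uv.1⁻¹ * uv.2⁻¹).prod = w := by
  rw [commutator_eq_closure] at hw
  induction hw using Subgroup.closure_induction'' with
  | mem g hg =>
    obtain ⟨u, v, rfl⟩ := hg
    exact ⟨[(u, v)], by simp [commutatorElement_def]⟩
  | inv_mem g hg =>
    obtain ⟨u, v, rfl⟩ := hg
    -- $[u,v]^{-1}=[v,u]$, so no inverses are needed in the list.
    exact ⟨[(v, u)], by simp [commutatorElement_def, mul_assoc]⟩
  | one => exact ⟨[], rfl⟩
  | mul a b _ _ ha hb =>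
    obtain ⟨l, rfl⟩ := ha
    obtain ⟨l', rfl⟩ := hb
    exact ⟨l ++ l', by simp⟩

theorem nonempty_commutatorPresentation {ℓ : ℕ} {n : Fin ℓ → ℕ} (t : Tower n) :
    Nonempty (CommutatorPresentation t) := by
  have h : ∀ (i j : Fin ℓ) (_ : i < j) (p : Fin (n i)) (q : Fin (n j)),
      ∃ l : List (FreeGroup (Fin (n j)) × FreeGroup (Fin (n j))), t.x j q * t.x i p =
        t.x i p * t.x j q * t.incl j ((l.map fun uv => uv.1 * uv.2 * uv.1⁻¹ * uv.2⁻¹).prod) := by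
    intro i j hij p q
    obtain ⟨w, hw, hr⟩ := t.exists_relation i j hij p q
    obtain ⟨l, rfl⟩ := exists_prod_commutators hw
    exact ⟨l, hr⟩
  choose pairs rel using h
  exact ⟨⟨pairs, rel⟩⟩

/-! ### Augmented Fox derivatives are exponent sums -/

theorem aug_single {X : Type} (u : FreeGroup X) : aug (MonoidAlgebra.single u 1) = 1 := by
  simp [aug]

/-- The map `w ↦ ε(∂w/∂a)` is the homomorphism that counts the exponents of `a`. -/
def exponentSum {X : Type} [DecidableEq X] (a : X) : FreeGroup X →* Multiplicative ℤ where
  toFun w := .ofAdd (aug (fox w a))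
  map_one' := by simp [fox]
  map_mul' u v := by rw [fox_mul, map_add, map_mul, aug_single, one_mul, ofAdd_add]

variable {ℓ : ℕ} {n : Fin ℓ → ℕ}

/-- The standard generator `t_a` of `ℤ^N`. -/
def genZ (a : Gen n) : ZN n := .ofAdd (Pi.single a 1)

theorem e_genZ (a b : Gen n) : (e a (genZ b)).toAdd = if a = b then 1 else 0 :=
  Pi.single_apply b (1 : ℤ) a

theorem aug_fox_toFN (t : Tower n) (j : Fin ℓ) (w : FreeGroup (Fin (n j))) (a : Gen n) :
    aug (fox (toFN (n := n) j w) a) = (e a (t.ab (t.incl j w))).toAdd := by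
  have h : (exponentSum a).comp (FreeGroup.map fun p => (⟨j, p⟩ : Gen n)) =
      ((e a).comp t.ab).comp (t.incl j) := FreeGroup.ext_hom _ _ fun p => by
    have h1 : t.ab (t.incl j (FreeGroup.of p)) = genZ ⟨j, p⟩ := t.ab_x j p
    simp only [MonoidHom.comp_apply, FreeGroup.map.of, h1]
    apply Multiplicative.toAdd.injective
    rw [e_genZ]
    change aug (fox (FreeGroup.of _) a) = _
    rw [fox_of, Pi.single_apply]
    split_ifs <;> simp
  exact congrArg Multiplicative.toAdd (DFunLike.congr_fun h w)

theorem e_ab_incl_of_ne (t : Tower n) {j : Fin ℓ} (w : FreeGroup (Fin (n j))) {a : Gen n}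
    (h : a.1 ≠ j) : (e a (t.ab (t.incl j w))).toAdd = 0 := by
  have h' : ((e a).comp t.ab).comp (t.incl j) = 1 := FreeGroup.ext_hom _ _ fun p => by
    have h1 : t.ab (t.incl j (FreeGroup.of p)) = genZ ⟨j, p⟩ := t.ab_x j p
    simp only [MonoidHom.comp_apply, h1]
    apply Multiplicative.toAdd.injective
    rw [e_genZ, if_neg fun h2 => h (congrArg Sigma.fst h2)]
    rfl
  exact congrArg Multiplicative.toAdd (DFunLike.congr_fun h' w)

/-- This is the bridge from Fox calculus to cohomology: both sides are the $2\times2$ minor of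
exponent sums of $u$ and $v$ at $a$ and $b$. -/
theorem foxMinor_toFN (t : Tower n) (j : Fin ℓ) (u v : FreeGroup (Fin (n j))) (a b : Gen n) :
    foxMinor (toFN (n := n) j u) (toFN (n := n) j v) a b =
      H2Z.alt (t.ab (t.incl j u)) (t.ab (t.incl j v)) (cup (e a) (e b)) := by
  rw [foxMinor, aug_fox_toFN t, aug_fox_toFN t, aug_fox_toFN t, aug_fox_toFN t, H2Z.alt_cup]
  ring

/-! ### The second cohomology of `ℤ^N` -/

/-- The class `e_{i,p} e_{j,q}`, `i < j`. -/
def cupMixed (ρ : Mixed n) : H2Z (ZN n) := cup (e ⟨ρ.1.1.1, ρ.2.1⟩) (e ⟨ρ.1.1.2, ρ.2.2⟩)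

/-- The class `e_{j,p} e_{j,q}`, `p < q`. -/
def cupDiag (σ : Diag n) : H2Z (ZN n) := cup (e ⟨σ.1, σ.2.1.1⟩) (e ⟨σ.1, σ.2.1.2⟩)

/-- The coefficient of `e_{i,p} e_{j,q}`, `i < j`. -/
def coeffMixed (ρ : Mixed n) : H2Z (ZN n) →ₗ[ℤ] ℤ :=
  H2Z.alt (genZ ⟨ρ.1.1.1, ρ.2.1⟩) (genZ ⟨ρ.1.1.2, ρ.2.2⟩)

/-- The coefficient of `e_{j,p} e_{j,q}`, `p < q`. -/
def coeffDiag (σ : Diag n) : H2Z (ZN n) →ₗ[ℤ] ℤ :=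
  H2Z.alt (genZ ⟨σ.1, σ.2.1.1⟩) (genZ ⟨σ.1, σ.2.1.2⟩)

theorem alt_genZ_cup (a b c d : Gen n) : H2Z.alt (genZ a) (genZ b) (cup (e c) (e d)) =
    (if c = a ∧ d = b then 1 else 0) - if c = b ∧ d = a then 1 else 0 := by
  rw [H2Z.alt_cup, e_genZ, e_genZ, e_genZ, e_genZ]
  simp only [ite_and, mul_ite, mul_one, mul_zero]
  split_ifs <;> simp_all

theorem coeffMixed_cupMixed (ρ τ : Mixed n) :
    coeffMixed ρ (cupMixed τ) = if τ = ρ then 1 else 0 := by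
  obtain ⟨⟨⟨i, j⟩, h⟩, p, q⟩ := ρ
  obtain ⟨⟨⟨i', j'⟩, h'⟩, p', q'⟩ := τ
  dsimp only at h h' p q p' q'
  rw [coeffMixed, cupMixed, alt_genZ_cup]
  dsimp only
  rw [if_neg (c := (⟨i', p'⟩ : Gen n) = ⟨j, q⟩ ∧ _) (fun hc => ?_), sub_zero]
  · refine if_congr ⟨fun hc => ?_, fun hc => ?_⟩ rfl rfl
    · obtain ⟨h1, h2⟩ := hc
      cases h1
      cases h2
      rfl
    · cases hc
      exact ⟨rfl, rfl⟩
  · have h1 : i' = j := congrArg Sigma.fst hc.1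
    have h2 : j' = i := congrArg Sigma.fst hc.2
    subst h1 h2
    exact lt_asymm h h'

theorem coeffDiag_cupDiag (σ τ : Diag n) :
    coeffDiag σ (cupDiag τ) = if τ = σ then 1 else 0 := by
  obtain ⟨j, ⟨p, q⟩, h⟩ := σ
  obtain ⟨j', ⟨p', q'⟩, h'⟩ := τ
  dsimp only at h h'
  rw [coeffDiag, cupDiag, alt_genZ_cup]
  dsimp only
  rw [if_neg (c := (⟨j', p'⟩ : Gen n) = ⟨j, q⟩ ∧ _) (fun hc => ?_), sub_zero]
  · refine if_congr ⟨fun hc => ?_, fun hc => ?_⟩ rfl rfl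
    · obtain ⟨h1, h2⟩ := hc
      cases h1
      cases h2
      rfl
    · cases hc
      exact ⟨rfl, rfl⟩
  · obtain ⟨h1, h2⟩ := hc
    cases h1
    cases h2
    exact lt_asymm h h'

theorem coeffMixed_cupDiag (ρ : Mixed n) (σ : Diag n) : coeffMixed ρ (cupDiag σ) = 0 := by
  rw [coeffMixed, cupDiag, alt_genZ_cup, if_neg, if_neg, sub_zero]
  · intro hc
    exact ρ.1.2.ne ((congrArg Sigma.fst hc.2).symm.trans (congrArg Sigma.fst hc.1))
  · intro hc
    exact ρ.1.2.ne ((congrArg Sigma.fst hc.1).symm.trans (congrArg Sigma.fst hc.2))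

theorem coeffDiag_cupMixed (σ : Diag n) (ρ : Mixed n) : coeffDiag σ (cupMixed ρ) = 0 := by
  rw [coeffDiag, cupMixed, alt_genZ_cup, if_neg, if_neg, sub_zero]
  · intro hc
    exact ρ.1.2.ne ((congrArg Sigma.fst hc.1).trans (congrArg Sigma.fst hc.2).symm)
  · intro hc
    exact ρ.1.2.ne ((congrArg Sigma.fst hc.1).trans (congrArg Sigma.fst hc.2).symm)

theorem eq_zero_of_coeff (x : H2Z (ZN n)) (hM : ∀ ρ, coeffMixed ρ x = 0)
    (hD : ∀ σ, coeffDiag σ x = 0) : x = 0 := by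
  have swap : ∀ a b : Gen n, H2Z.alt (genZ b) (genZ a) x = 0 → H2Z.alt (genZ a) (genZ b) x = 0 :=
    fun a b h => by rw [H2Z.alt_swap, h, neg_zero]
  have hM' : ∀ a b : Gen n, a.1 < b.1 → H2Z.alt (genZ a) (genZ b) x = 0 :=
    fun a b h => hM ⟨⟨(a.1, b.1), h⟩, (a.2, b.2)⟩
  refine mk_eq_zero_of_alt x fun a b => ?_
  change H2Z.alt (genZ a) (genZ b) x = 0
  rcases lt_trichotomy a.1 b.1 with h | h | h
  · exact hM' a b h
  · obtain ⟨j, p⟩ := a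
    obtain ⟨j', q⟩ := b
    obtain rfl : j = j' := h
    rcases lt_trichotomy p q with h | rfl | h
    · exact hD ⟨j, ⟨(p, q), h⟩⟩
    · exact H2Z.alt_self _ x
    · exact swap _ _ (hD ⟨j, ⟨(q, p), h⟩⟩)
  · exact swap _ _ (hM' b a h)

/-- The coefficient functionals are dual to the cup products and jointly injective, so the
difference of the two sides vanishes. -/
theorem eq_sum_coeff (x : H2Z (ZN n)) :
    x = ∑ ρ, coeffMixed ρ x • cupMixed ρ + ∑ σ, coeffDiag σ x • cupDiag σ := by
  rw [← sub_eq_zero]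
  refine eq_zero_of_coeff _ (fun ρ => ?_) fun σ => ?_
  · simp [coeffMixed_cupMixed, coeffMixed_cupDiag]
  · simp [coeffDiag_cupMixed, coeffDiag_cupDiag]

/-- In a mixed product at least one factor comes from a free group other than $F_{n_j}$ and vanishes
on words in $F_{n_j}$; only diagonal terms survive. -/
theorem alt_ab_incl (t : Tower n) {j : Fin ℓ} (u v : FreeGroup (Fin (n j))) (x : H2Z (ZN n)) :
    H2Z.alt (t.ab (t.incl j u)) (t.ab (t.incl j v)) x = ∑ σ : Diag n, coeffDiag σ x *
      foxMinor (toFN (n := n) j u) (toFN (n := n) j v) ⟨σ.1, σ.2.1.1⟩ ⟨σ.1, σ.2.1.2⟩ := by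
  have hM : ∀ ρ : Mixed n,
      H2Z.alt (t.ab (t.incl j u)) (t.ab (t.incl j v)) (cupMixed ρ) = 0 := fun ρ => by
    rw [cupMixed, H2Z.alt_cup]
    by_cases h : ρ.1.1.1 = j
    · have h' : ρ.1.1.2 ≠ j := fun h' => ρ.1.2.ne (h.trans h'.symm)
      simp [e_ab_incl_of_ne t (a := ⟨ρ.1.1.2, ρ.2.2⟩) _ h']
    · simp [e_ab_incl_of_ne t (a := ⟨ρ.1.1.1, ρ.2.1⟩) _ h]
  conv_lhs => rw [eq_sum_coeff x]
  simp only [map_add, map_sum, map_zsmul, smul_eq_mul, hM, mul_zero, Finset.sum_const_zero, zero_add,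
    foxMinor_toFN t, cupDiag]

theorem sum_alt_pairs (t : Tower n) {j : Fin ℓ}
    (l : List (FreeGroup (Fin (n j)) × FreeGroup (Fin (n j)))) (x : H2Z (ZN n)) :
    (l.map fun uv => H2Z.alt (t.ab (t.incl j uv.1)) (t.ab (t.incl j uv.2)) x).sum =
      ∑ σ : Diag n, coeffDiag σ x * (l.map fun uv => foxMinor (toFN (n := n) j uv.1)
        (toFN (n := n) j uv.2) ⟨σ.1, σ.2.1.1⟩ ⟨σ.1, σ.2.1.2⟩).sum := by
  induction l with
  | nil => simp
  | cons a l ih =>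
    simp only [List.map_cons, List.sum_cons, mul_add, Finset.sum_add_distrib, ← ih]
    rw [alt_ab_incl]

/-! ### The kernel of `𝔞^*` -/

theorem lift_prod_commutators (t : Tower n) {f : Z2 (ZN n)} {j : Fin ℓ}
    (T : FreeGroup (Fin (n j)) →* CocycleExt f) (hT : ∀ w, (T w).g = t.ab (t.incl j w))
    (l : List (FreeGroup (Fin (n j)) × FreeGroup (Fin (n j)))) :
    T ((l.map fun uv => uv.1 * uv.2 * uv.1⁻¹ * uv.2⁻¹).prod) =
      CocycleExt.central f (.ofAdd (l.map fun uv =>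
        H2Z.alt (t.ab (t.incl j uv.1)) (t.ab (t.incl j uv.2)) (H2Z.mk _ f)).sum) := by
  induction l with
  | nil => simp
  | cons a l ih =>
    rw [List.map_cons, List.prod_cons, map_mul, ih, List.map_cons, List.sum_cons, ofAdd_add,
      map_mul (CocycleExt.central f), H2Z.alt_mk, ← hT, ← hT, ← CocycleExt.commutator_eq_central]
    simp only [map_mul, map_inv]

theorem pullback_ab_eq_zero_iff {t : Tower n} (D : CommutatorPresentation t) (x : H2Z (ZN n)) :
    H2Z.pullback t.ab x = 0 ↔ ∀ ρ, -coeffMixed ρ x = ∑ σ, coeffDiag σ x * D.C ρ σ := by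
  obtain ⟨f, rfl⟩ := H2Z.mk_surjective _ x
  have hC : ∀ ρ : Mixed n, ∑ σ, coeffDiag σ (H2Z.mk _ f) * D.C ρ σ =
      ((D.pairs ρ.1.1.1 ρ.1.1.2 ρ.1.2 ρ.2.1 ρ.2.2).map fun uv =>
        H2Z.alt (t.ab (t.incl _ uv.1)) (t.ab (t.incl _ uv.2)) (H2Z.mk _ f)).sum :=
    fun ρ => (sum_alt_pairs t _ _).symm
  -- The relation interchanges $b$ and $a$, while `coeffMixed` pairs $a$ with $b$; antisymmetry
  -- accounts for the minus sign. Arbitrary lifts are allowed.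
  have relation_iff : ∀ (ρ : Mixed n) (a b : CocycleExt f), a.g = genZ ⟨ρ.1.1.1, ρ.2.1⟩ →
      b.g = genZ ⟨ρ.1.1.2, ρ.2.2⟩ → (-coeffMixed ρ (H2Z.mk _ f) =
        ∑ σ, coeffDiag σ (H2Z.mk _ f) * D.C ρ σ ↔ b * a = a * b * CocycleExt.central f
          (.ofAdd (∑ σ, coeffDiag σ (H2Z.mk _ f) * D.C ρ σ))) := fun ρ a b ha hb => by
    rw [CocycleExt.mul_eq_central b a, ← CocycleExt.central_mul_comm, mul_left_inj,
      CocycleExt.central_injective.eq_iff, Multiplicative.ofAdd.injective.eq_iff, ha, hb,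
      ← H2Z.alt_mk, H2Z.alt_swap]
    rfl
  refine (H2Z.pullback_H2π_eq_zero_iff t.ab f).trans ⟨?_, fun h => ?_⟩
  · rintro ⟨s, hs⟩ ρ
    rw [relation_iff ρ (s (t.x _ ρ.2.1)) (s (t.x _ ρ.2.2)) ((hs _).trans (t.ab_x _ _))
      ((hs _).trans (t.ab_x _ _)), hC,
      ← lift_prod_commutators t (s.comp (t.incl _)) (fun w => hs _), ← map_mul, D.rel _ _ ρ.1.2,
      map_mul, map_mul]
    rfl
  · have hT : ∀ (j : Fin ℓ) (w : FreeGroup (Fin (n j))), (FreeGroup.lift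
        (fun q => (⟨0, genZ ⟨j, q⟩⟩ : CocycleExt f)) w).g = t.ab (t.incl j w) := fun j w => by
      refine DFunLike.congr_fun (f := (CocycleExt.proj f).comp (FreeGroup.lift
        (fun q => (⟨0, genZ ⟨j, q⟩⟩ : CocycleExt f)))) (g := t.ab.comp (t.incl j))
        (FreeGroup.ext_hom _ _ fun q => ?_) w
      simp only [MonoidHom.comp_apply, FreeGroup.lift_apply_of, CocycleExt.proj_apply]
      exact (t.ab_x j q).symm
    -- The central coordinate $0$ is an arbitrary choice: changing the lifts by central elements
    -- does not affect the relations.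
    obtain ⟨s, hs⟩ := t.exists_lift _ D.rel (fun i p => (⟨0, genZ ⟨i, p⟩⟩ : CocycleExt f))
      fun i j hij p q => by
        let ρ : Mixed n := ⟨⟨(i, j), hij⟩, (p, q)⟩
        refine ((relation_iff ρ _ _ rfl rfl).1 (h ρ)).trans ?_
        rw [hC, lift_prod_commutators t _ (hT j)]
    refine ⟨s, fun g => DFunLike.congr_fun (f := (CocycleExt.proj f).comp s) (g := t.ab)
      (t.hom_ext fun i p => ?_) g⟩
    rw [MonoidHom.comp_apply, hs, t.ab_x]
    rfl

theorem CommutatorPresentation.C_eq_zero {t : Tower n} (D : CommutatorPresentation t) {ρ : Mixed n}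
    {σ : Diag n} (h : σ.1 ≠ ρ.1.1.2) : D.C ρ σ = 0 := by
  refine List.sum_eq_zero fun m hm => ?_
  obtain ⟨uv, -, rfl⟩ := List.mem_map.1 hm
  rw [foxMinor_toFN t, H2Z.alt_cup, e_ab_incl_of_ne t (a := ⟨σ.1, σ.2.1.1⟩) _ h,
    e_ab_incl_of_ne t (a := ⟨σ.1, σ.2.1.1⟩) _ h]
  simp

/-- The sum in `eta` only meets rows whose second index is `σ.1`. The hypothesis, satisfied by $-C$
because of its block form, lets it run over a full column. -/
theorem eta_eq_sum (K : Matrix (Mixed n) (Diag n) ℤ) (σ : Diag n)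
    (hK : ∀ ρ : Mixed n, σ.1 ≠ ρ.1.1.2 → K ρ σ = 0) :
    eta K σ = cupDiag σ + ∑ ρ, K ρ σ • cupMixed ρ := by
  rw [eta, cupDiag]
  congr 1
  have h := Fintype.sum_of_injective
    (fun a : (i : {i : Fin ℓ // i < σ.1}) × (Fin (n i.1) × Fin (n σ.1)) =>
      (⟨⟨(a.1.1, σ.1), a.1.2⟩, a.2⟩ : Mixed n)) ?_
    (fun a => K ⟨⟨(a.1.1, σ.1), a.1.2⟩, a.2⟩ σ • cupMixed ⟨⟨(a.1.1, σ.1), a.1.2⟩, a.2⟩)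
    (fun ρ => K ρ σ • cupMixed ρ) ?_ fun a => rfl
  · rw [← h, Fintype.sum_sigma]
    refine Finset.sum_congr rfl fun i _ => ?_
    rw [Fintype.sum_prod_type]
    rfl
  · rintro ⟨⟨i, hi⟩, p⟩ ⟨⟨i', hi'⟩, p'⟩ h
    cases h
    rfl
  · rintro ⟨⟨⟨i, j⟩, hij⟩, p⟩ hρ
    rw [hK, zero_smul]
    rintro rfl
    exact hρ ⟨⟨⟨i, hij⟩, p⟩, rfl⟩

theorem CommutatorPresentation.coeffDiag_eta {t : Tower n} (D : CommutatorPresentation t)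
    (σ τ : Diag n) : coeffDiag σ (eta (-D.C) τ) = if τ = σ then 1 else 0 := by
  rw [eta_eq_sum _ _ fun ρ h => by rw [Matrix.neg_apply, D.C_eq_zero h, neg_zero]]
  simp [coeffDiag_cupDiag, coeffDiag_cupMixed]

theorem CommutatorPresentation.coeffMixed_eta {t : Tower n} (D : CommutatorPresentation t)
    (ρ : Mixed n) (σ : Diag n) : coeffMixed ρ (eta (-D.C) σ) = -D.C ρ σ := by
  rw [eta_eq_sum _ _ fun ρ h => by rw [Matrix.neg_apply, D.C_eq_zero h, neg_zero]]
  simp [coeffMixed_cupDiag, coeffMixed_cupMixed]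

theorem CommutatorPresentation.linearIndependent_eta {t : Tower n} (D : CommutatorPresentation t) :
    LinearIndependent ℤ (eta (-D.C)) := by
  rw [Fintype.linearIndependent_iff]
  intro c hc σ
  simpa [D.coeffDiag_eta] using congrArg (coeffDiag σ) hc

/-- On the kernel the mixed coordinates are determined by the diagonal ones, and the diagonal
coordinates of the $\eta$ form the identity matrix. Subtracting the combination of the $\eta$ with
the same diagonal coordinates therefore leaves zero. -/
theorem CommutatorPresentation.span_eta {t : Tower n} (D : CommutatorPresentation t) :
    Submodule.span ℤ (Set.range (eta (-D.C))) = LinearMap.ker (H2Z.pullback t.ab) := by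
  apply le_antisymm
  · rw [Submodule.span_le]
    rintro _ ⟨σ, rfl⟩
    refine (pullback_ab_eq_zero_iff D _).2 fun ρ => ?_
    simp [D.coeffDiag_eta, D.coeffMixed_eta]
  · intro x hx
    have hx' := (pullback_ab_eq_zero_iff D x).1 hx
    have h : x = ∑ σ, coeffDiag σ x • eta (-D.C) σ := by
      rw [← sub_eq_zero]
      refine eq_zero_of_coeff _ (fun ρ => ?_) fun σ => ?_
      · simp [D.coeffMixed_eta, ← hx']
      · simp [D.coeffDiag_eta]
    rw [h]
    exact Submodule.sum_mem _ fun σ _ =>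
      zsmul_mem (Submodule.subset_span (Set.mem_range_self σ)) _

theorem CommutatorPresentation.A_mul_matB {t : Tower n} (D : CommutatorPresentation t)
    (K : Matrix (Mixed n) (Diag n) ℤ) : D.A * matB K = K + D.C := by
  rw [CommutatorPresentation.A, matB, Matrix.fromCols_mul_fromRows, Matrix.one_mul, Matrix.mul_one]

end AlmostDirect

end

theorem corollary2p5 {ℓ : ℕ} (n : Fin ℓ → ℕ) (t : AlmostDirect.Tower n) :
    (Function.Surjective t.ab ∧ t.ab.ker = commutator t.Grp) ∧
    Nonempty (AlmostDirect.CommutatorPresentation t) ∧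
    ∀ D : AlmostDirect.CommutatorPresentation t,
      ∃ K : Matrix (AlmostDirect.Mixed n) (AlmostDirect.Diag n) ℤ,
        D.A * AlmostDirect.matB K = 0 ∧
        (∀ K', D.A * AlmostDirect.matB K' = 0 → K' = K) ∧
        K = -D.C ∧
        LinearIndependent ℤ (AlmostDirect.eta K) ∧
        Submodule.span ℤ (Set.range (AlmostDirect.eta K)) =
          LinearMap.ker (AlmostDirect.H2Z.pullback t.ab) := by
  refine ⟨⟨t.ab_surjective, t.ker_ab⟩, AlmostDirect.nonempty_commutatorPresentation t, fun D =>
    ⟨-D.C, ?_, fun K' h => ?_, rfl, D.linearIndependent_eta, D.span_eta⟩⟩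
  · rw [D.A_mul_matB, neg_add_cancel]
  · rw [D.A_mul_matB] at h
    exact eq_neg_of_add_eq_zero_left h
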